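/- **Setting.** Fix an integer $k\ge 0$. Let $(\mathbb M_i,\mu_i)$, $i=1,\dots,k$, and $(\Theta,\nu)$ be measurable spaces with countably generated $\sigma$-algebras and $\sigma$-finite measures; put $\mathbb M=\prod_{i=1}^k\mathbb M_i$ and $\mu=\bigotimes_{i=1}^k\mu_i$. Let $\Pi$ be a probability distribution on $\mathbb M\times\Theta$ (the joint posterior of the missing data $D=(D_1,\dots,D_k)$ and the parameter $\theta$ given the observed data) with density $f(D,\theta)$ with respect to $\mu\times\nu$. Assume that $D_1,\dots,D_k$ are conditionally independent given $\theta$: there are jointly measurable $f_i(D_i\mid\theta)\ge 0$ with $\int f_i(\cdot\mid\theta)\,d\mu_i=1$ for every $\theta$, and a jointly measurable $f(\theta\mid D)\ge0$ with $\int f(\cdot\mid D)\,d\nu=1$ for every $D$, such that, for $\mu\times\nu$-almost every $(D,\theta)$, $$f(D,\theta)=\Big(\prod_{i=1}^k f_i(D_i\mid\theta)\Big)\int f(D',\theta)\,\mu(dD')\quad\text{and}\quad f(D,\theta)=f(\theta\mid D)\int f(D,\theta')\,\nu(d\theta').$$ **The chains.** The parent DA (data augmentation) chain on $\mathbb M\times\Theta$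 moves from $(D,\theta)$ to $(D',\theta')$ by drawing independently $D_i'\sim f_i(\cdot\mid\theta)$, $i=1,\dots,k$, and then $\theta'\sim f(\cdot\mid D')$; its transition kernel is $K_{DA}$. Let $r\in(0,1)$, and for each $\theta$ let $q(\cdot\mid\theta)$ be a probability distribution on the subsets of $\{1,\dots,k\}$, measurable in $\theta$, that charges only sets $S$ with $\big||S|-rk\big|<1$ (that is, $|S|=rk$, or $rk$ rounded up or down if it is not an integer). Let $\varepsilon\in[0,1]$. The ADDA (asynchronous and distributed data augmentation) chain moves from $(D,\theta)$ to $(D',\theta')$ as follows. With probability $\varepsilon$ put $S=\{1,\dots,k\}$, and with probability $1-\varepsilon$ draw $S\sim q(\cdot\mid\theta)$. Independently of the choice of $S$ draw, independently for $i\in S$, $D'_i\sim f_i(\cdot\mid\theta)$; put $D'_i=D_i$ for $i\notin S$; finally draw $\theta'\sim f(\cdot\mid D')$. A Markov chain with transition kernel $K$ is called Harris ergodic with stationary distribution $\Pi$ if the probability measure $\Pi$ is invariant for $K$ and the chain is $\Pi$-irreducible, aperiodic, and Harris recurrent (from every starting point, every measurable set $A$ with $\Pi(A)>0$ is visited infinitely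 often almost surely). **Theorem.** Suppose that $\varepsilon>0$, that $K_{DA}((D,\theta),\cdot)$ is absolutely continuous with respect to $\Pi$ for every $(D,\theta)\in\mathbb M\times\Theta$, and that the parent DA chain is Harris ergodic with stationary distribution $\Pi$. Then the ADDA chain is Harris ergodic with stationary distribution $\Pi$. -/

import Mathlib

open MeasureTheory ProbabilityTheory Filter
open scoped ENNReal

noncomputable section

/-! ### Harris ergodic Markov chains -/

section Chain

variable {X : Type*} [MeasurableSpace X]

/-- The one-step transition rule at time `n` of the time-homogeneous Markov chain with transition
kernel `K`, as a kernel from the history up to time `n`: it only looks at the current state. -/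
def markovStep (K : Kernel X X) (n : ℕ) : Kernel ((i : Finset.Iic n) → (fun _ : ℕ => X) i) X :=
  K.comap (fun h => h ⟨n, Finset.mem_Iic.2 le_rfl⟩) (measurable_pi_apply _)

instance (K : Kernel X X) [IsMarkovKernel K] (n : ℕ) : IsMarkovKernel (markovStep K n) := by
  unfold markovStep; infer_instance

/-- The law, on the space `ℕ → X` of trajectories, of the Markov chain with transition kernel `K`
started at `x`. -/
def chainLaw (K : Kernel X X) [IsMarkovKernel K] (x : X) : Measure (ℕ → X) :=
  Kernel.traj (X := fun _ : ℕ => X) (markovStep K) 0 (fun _ => x)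

/-- Aperiodicity with respect to `π`: there are no `d ≥ 2` and pairwise disjoint measurable sets
`E 0, …, E (d - 1)` of positive `π`-measure through which the chain moves cyclically. -/
def IsAperiodicChain (K : Kernel X X) (π : Measure X) : Prop :=
  ¬ ∃ (d : ℕ) (E : ZMod d → Set X), 2 ≤ d ∧ (∀ i, MeasurableSet (E i)) ∧
    Pairwise (fun i j => Disjoint (E i) (E j)) ∧ (∀ i, 0 < π (E i)) ∧
    ∀ i, ∀ x ∈ E i, K x (E (i + 1)) = 1

/-- Harris recurrence with respect to `π`: from every starting point, every measurable set of
positive `π`-measure is almost surely visited infinitely often. -/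
def IsHarrisRecurrent (K : Kernel X X) [IsMarkovKernel K] (π : Measure X) : Prop :=
  ∀ A : Set X, MeasurableSet A → 0 < π A →
    ∀ x : X, ∀ᵐ ω ∂(chainLaw K x), ∃ᶠ n in atTop, ω n ∈ A

/-- The Markov chain with transition kernel `K` is Harris ergodic with stationary distribution
`π`: the probability measure `π` is invariant, and the chain is `π`-irreducible, aperiodic and
Harris recurrent. -/
structure IsHarrisErgodic (K : Kernel X X) [IsMarkovKernel K] (π : Measure X) : Prop where
  isProbabilityMeasure : IsProbabilityMeasure π
  invariant : K.Invariant π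
  irreducible : K.IsIrreducible π
  aperiodic : IsAperiodicChain K π
  harrisRecurrent : IsHarrisRecurrent K π

end Chain

/-! ### Products of Markov kernels -/

section PiKernel

variable {ι : Type*} [Fintype ι] {α : Type*} [MeasurableSpace α]
  {M : ι → Type*} [∀ i, MeasurableSpace (M i)]

/-- Given `a`, draw the coordinates independently, the `i`-th one from `κ i a`. -/
def piKernel (κ : (i : ι) → Kernel α (M i)) [∀ i, IsMarkovKernel (κ i)] :
    Kernel α ((i : ι) → M i) where
  toFun a := Measure.pi (fun i => κ i a)
  measurable' := by
    refine Measurable.measure_of_isPiSystem_of_isProbabilityMeasure generateFrom_pi.symm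
      isPiSystem_pi ?_
    rintro _ ⟨t, ht, rfl⟩
    simp_rw [Measure.pi_pi]
    exact Finset.measurable_prod _ fun i _ => (κ i).measurable_coe (ht i (Set.mem_univ i))

instance (κ : (i : ι) → Kernel α (M i)) [∀ i, IsMarkovKernel (κ i)] :
    IsMarkovKernel (piKernel κ) :=
  ⟨fun a => inferInstanceAs (IsProbabilityMeasure (Measure.pi fun i => κ i a))⟩

end PiKernel

/-! ### The Bayesian model, the parent DA chain and the ADDA chain -/

section Model

variable {k : ℕ} {M : Fin k → Type*} [∀ i, MeasurableSpace (M i)] {Θ : Type*} [MeasurableSpace Θ]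

/-- The posterior (given the observed data, which is fixed and suppressed) of the missing data
`D = (D 1, …, D k)` and the parameter `θ`, with versions of its conditional densities.
The reference measure for the missing data is the product of the `μ i`. -/
structure DAModel (μ : (i : Fin k) → Measure (M i)) (ν : Measure Θ) where
  /-- the joint posterior density `f(D, θ)` -/
  joint : ((i : Fin k) → M i) × Θ → ℝ≥0∞
  /-- the conditional density `f_i(D_i | θ)` of the `i`-th block of missing data -/
  block : (i : Fin k) → Θ → M i → ℝ≥0∞
  /-- the conditional density `f(θ | D)` of the parameter -/
  param : ((i : Fin k) → M i) → Θ → ℝ≥0∞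
  measurable_joint : Measurable joint
  measurable_block : ∀ i, Measurable (Function.uncurry (block i))
  measurable_param : Measurable (Function.uncurry param)
  lintegral_joint : ∫⁻ x, joint x ∂((Measure.pi μ).prod ν) = 1
  lintegral_block : ∀ i θ, ∫⁻ y, block i θ y ∂(μ i) = 1
  lintegral_param : ∀ D, ∫⁻ θ, param D θ ∂ν = 1
  /-- The blocks are conditionally independent given `θ`, the `i`-th one with density `f_i`:
  `f(D, θ) = f(D | θ) f(θ)` with `f(D | θ) = ∏ i, f_i(D_i | θ)` and `f(θ) = ∫ f(D, θ) dD`. -/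
  joint_eq_block : ∀ᵐ x ∂((Measure.pi μ).prod ν),
    joint x = (∏ i, block i x.2 (x.1 i)) * ∫⁻ D, joint (D, x.2) ∂(Measure.pi μ)
  /-- `f(D, θ) = f(θ | D) f(D)` with `f(D) = ∫ f(D, θ) dθ`. -/
  joint_eq_param : ∀ᵐ x ∂((Measure.pi μ).prod ν),
    joint x = param x.1 x.2 * ∫⁻ θ, joint (x.1, θ) ∂ν

/-- A rule for choosing the set of workers that return an update in the `r`-fraction regime. The
probability `prob S θ` of choosing the set `S` may depend on the current parameter `θ`.
Only sets with `r * k` elements (rounded up or down, if this is not an integer) are chosen. -/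
structure FractionRule (k : ℕ) (Θ : Type*) [MeasurableSpace Θ] (r : ℝ) where
  prob : Finset (Fin k) → Θ → ℝ≥0∞
  measurable_prob : ∀ S, Measurable (prob S)
  sum_prob : ∀ θ, ∑ S, prob S θ = 1
  card_fraction : ∀ S θ, prob S θ ≠ 0 → |(S.card : ℝ) - r * k| < 1

namespace DAModel

variable {μ : (i : Fin k) → Measure (M i)} {ν : Measure Θ} [∀ i, SigmaFinite (μ i)] [SigmaFinite ν]

/-- The joint posterior distribution `Π` of `(D, θ)`. -/
def posterior (m : DAModel μ ν) : Measure (((i : Fin k) → M i) × Θ) :=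
  ((Measure.pi μ).prod ν).withDensity m.joint

/-- The kernel `θ ↦ f_i(· | θ) dμ_i`: worker `i` draws block `i` of the missing data. -/
def blockKernel (m : DAModel μ ν) (i : Fin k) : Kernel Θ (M i) :=
  (Kernel.const Θ (μ i)).withDensity (m.block i)

instance (m : DAModel μ ν) (i : Fin k) : IsMarkovKernel (m.blockKernel i) := by
  refine ⟨fun θ => ⟨?_⟩⟩
  rw [blockKernel, Kernel.withDensity_apply' _ (m.measurable_block i)]
  simpa using m.lintegral_block i θ

/-- The kernel `D ↦ f(· | D) dν` from which the manager draws the parameter. -/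
def paramKernel (m : DAModel μ ν) : Kernel ((i : Fin k) → M i) Θ :=
  (Kernel.const _ ν).withDensity m.param

instance (m : DAModel μ ν) : IsMarkovKernel m.paramKernel := by
  refine ⟨fun D => ⟨?_⟩⟩
  rw [paramKernel, Kernel.withDensity_apply' _ m.measurable_param]
  simpa using m.lintegral_param D

/-- The new value of block `i` when exactly the workers in `S` return an update: a fresh draw from
`f_i(· | θ)` if `i ∈ S`, and the old value `D i` otherwise. -/
def blockUpdate (m : DAModel μ ν) (S : Finset (Fin k)) (i : Fin k) :
    Kernel (((i : Fin k) → M i) × Θ) (M i) :=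
  if i ∈ S then (m.blockKernel i).comap Prod.snd measurable_snd
  else Kernel.deterministic (fun x => x.1 i) ((measurable_pi_apply i).comp measurable_fst)

instance (m : DAModel μ ν) (S : Finset (Fin k)) (i : Fin k) :
    IsMarkovKernel (m.blockUpdate S i) := by
  unfold blockUpdate; split_ifs <;> infer_instance

/-- From `(D, θ)`, redraw independently the blocks in `S` and keep the others. For `S` the set of
all workers this is the I step of the parent DA algorithm. -/
def subsetIStep (m : DAModel μ ν) (S : Finset (Fin k)) :
    Kernel (((i : Fin k) → M i) × Θ) ((i : Fin k) → M i) :=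
  piKernel (m.blockUpdate S)

instance (m : DAModel μ ν) (S : Finset (Fin k)) : IsMarkovKernel (m.subsetIStep S) := by
  unfold subsetIStep; infer_instance

/-- The P step: from the new missing data `D'`, draw `θ'` from `f(· | D')` and return
`(D', θ')`. -/
def pStep (m : DAModel μ ν) : Kernel ((i : Fin k) → M i) (((i : Fin k) → M i) × Θ) :=
  Kernel.id.prod m.paramKernel

instance (m : DAModel μ ν) : IsMarkovKernel m.pStep := by
  unfold pStep; infer_instance

/-- The transition kernel `K_DA` of the parent DA chain: all blocks are redrawn, then the
parameter. -/
def daKernel (m : DAModel μ ν) : Kernel (((i : Fin k) → M i) × Θ) (((i : Fin k) → M i) × Θ) :=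
  m.pStep.comp (m.subsetIStep Finset.univ)

instance (m : DAModel μ ν) : IsMarkovKernel m.daKernel := by
  unfold daKernel; infer_instance

/-- The I step in the `r`-fraction regime: choose a set `S` of workers with probability
`q.prob S θ`, redraw the blocks in `S` and keep the others. -/
def fractionIStep (m : DAModel μ ν) {r : ℝ} (q : FractionRule k Θ r) :
    Kernel (((i : Fin k) → M i) × Θ) ((i : Fin k) → M i) :=
  ∑ S, (m.subsetIStep S).withDensity (fun x _ => q.prob S x.2)

instance (m : DAModel μ ν) {r : ℝ} (q : FractionRule k Θ r) :
    IsMarkovKernel (m.fractionIStep q) := by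
  refine ⟨fun x => ⟨?_⟩⟩
  rw [fractionIStep, Kernel.finsetSum_apply', ← q.sum_prob x.2]
  refine Finset.sum_congr rfl fun S _ => ?_
  have h : Measurable (Function.uncurry
      fun (x : ((i : Fin k) → M i) × Θ) (_ : (i : Fin k) → M i) => q.prob S x.2) :=
    (q.measurable_prob S).comp (measurable_snd.comp measurable_fst)
  rw [Kernel.withDensity_apply' _ h]
  simp

/-- The AD-I step: with probability `ε` all blocks are redrawn, with probability `1 - ε` only an
`r`-fraction of them. -/
def adIStep (m : DAModel μ ν) {r : ℝ} (q : FractionRule k Θ r) (ε : Set.Icc (0 : ℝ) 1) :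
    Kernel (((i : Fin k) → M i) × Θ) ((i : Fin k) → M i) :=
  (m.subsetIStep Finset.univ).withDensity (fun _ _ => ENNReal.ofReal ε) +
    (m.fractionIStep q).withDensity (fun _ _ => ENNReal.ofReal (1 - ε))

instance (m : DAModel μ ν) {r : ℝ} (q : FractionRule k Θ r) (ε : Set.Icc (0 : ℝ) 1) :
    IsMarkovKernel (m.adIStep q ε) := by
  refine ⟨fun x => ⟨?_⟩⟩
  have h : ENNReal.ofReal ε + ENNReal.ofReal (1 - ε) = 1 := by
    rw [← ENNReal.ofReal_add ε.2.1 (sub_nonneg.2 ε.2.2)]; simp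
  rw [adIStep, add_apply, Measure.add_apply,
    Kernel.withDensity_apply' _ measurable_const, Kernel.withDensity_apply' _ measurable_const]
  simpa using h

/-- The transition kernel `K_ADDA` of the ADDA chain on `(D, θ)`. -/
def addaKernel (m : DAModel μ ν) {r : ℝ} (q : FractionRule k Θ r) (ε : Set.Icc (0 : ℝ) 1) :
    Kernel (((i : Fin k) → M i) × Θ) (((i : Fin k) → M i) × Θ) :=
  m.pStep.comp (m.adIStep q ε)

instance (m : DAModel μ ν) {r : ℝ} (q : FractionRule k Θ r) (ε : Set.Icc (0 : ℝ) 1) :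
    IsMarkovKernel (m.addaKernel q ε) := by
  unfold addaKernel; infer_instance

end DAModel

end Model

end

/-! The ADDA kernel `L` dominates `ε` times the parent kernel `K`, because with probability `ε` all
blocks are redrawn. Irreducibility and aperiodicity pass from `K` to `L` by this domination alone.

Invariance is checked on the model. Given the parameter, the blocks are independent, so redrawing
any subset of them preserves their conditional law. The subset is chosen with probabilities
depending on the parameter only, so mixing over subsets does no harm. Hence the new missing data
have the marginal posterior law, and the P step turns that marginal back into the posterior
(`invariant_addaKernel`).

Harris recurrence requires a statement from every starting point. Let `u x` be the probability of
visiting `A` only finitely often from `x`. This function is harmonic for `L`. Poincaré recurrence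
and irreducibility give `u = 0` almost everywhere (`ae_transience_eq_zero`). Since `K x` is
absolutely continuous, it charges only the zeros of `u`, so `L x` gives these zeros mass at least
`ε`. Harmonicity then gives `sup u ≤ (1 - ε) sup u`, and so `u = 0` everywhere
(`isHarrisRecurrent_of_smul_le`). -/

noncomputable section

/-! ### The Markov property of the trajectory law. -/

section Trajectories

variable {X : Type*} [MeasurableSpace X]

/-- The law of the trajectory as a kernel in the starting point. -/
def chainKernel (K : Kernel X X) [IsMarkovKernel K] : Kernel X (ℕ → X) :=
  (Kernel.traj (X := fun _ : ℕ => X) (markovStep K) 0).comap (fun x _ => x) (by fun_prop)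

instance (K : Kernel X X) [IsMarkovKernel K] : IsMarkovKernel (chainKernel K) := by
  unfold chainKernel; infer_instance

lemma chainKernel_apply (K : Kernel X X) [IsMarkovKernel K] (x : X) :
    chainKernel K x = chainLaw K x := rfl

instance (K : Kernel X X) [IsMarkovKernel K] (x : X) : IsProbabilityMeasure (chainLaw K x) := by
  rw [← chainKernel_apply]; infer_instance

lemma measurable_chainLaw (K : Kernel X X) [IsMarkovKernel K] :
    Measurable (fun x => chainLaw K x) := (chainKernel K).measurable

lemma lintegral_chainLaw_zero (K : Kernel X X) [IsMarkovKernel K] (x : X) {f : X → ℝ≥0∞}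
    (hf : Measurable f) : ∫⁻ ω, f (ω 0) ∂(chainLaw K x) = f x := by
  have h : (chainLaw K x).map (Preorder.frestrictLe 0)
      = Measure.dirac (fun _ : Finset.Iic 0 => x) := by
    rw [chainLaw, ← Kernel.map_apply _ (by fun_prop), Kernel.traj_map_frestrictLe,
      Kernel.partialTraj_self, Kernel.id_apply]
  have hg : Measurable fun h : Finset.Iic 0 → X => f (h ⟨0, Finset.mem_Iic.2 le_rfl⟩) :=
    hf.comp (measurable_pi_apply _)
  calc ∫⁻ ω, f (ω 0) ∂(chainLaw K x)
      = ∫⁻ h, f (h ⟨0, Finset.mem_Iic.2 le_rfl⟩)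
          ∂((chainLaw K x).map (Preorder.frestrictLe 0)) := by
        rw [lintegral_map hg (by fun_prop)]; rfl
    _ = f x := by rw [h, lintegral_dirac' _ hg]

/-- Conditioning the next state on the history. -/
lemma lintegral_chainLaw_succ (K : Kernel X X) [IsMarkovKernel K] (x : X) (n : ℕ)
    {F : (Finset.Iic n → X) → ℝ≥0∞} (hF : Measurable F) {g : X → ℝ≥0∞} (hg : Measurable g) :
    ∫⁻ ω, F (Preorder.frestrictLe n ω) * g (ω (n + 1)) ∂(chainLaw K x)
      = ∫⁻ ω, F (Preorder.frestrictLe n ω) * (∫⁻ y, g y ∂(K (ω n))) ∂(chainLaw K x) := by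
  have h := Kernel.partialTraj_compProd_eq_map_traj (X := fun _ : ℕ => X) (κ := markovStep K)
    (Nat.zero_le n) (x₀ := fun _ => x)
  have hm : (chainLaw K x).map (Preorder.frestrictLe n)
      = Kernel.partialTraj (X := fun _ : ℕ => X) (markovStep K) 0 n (fun _ => x) := by
    rw [chainLaw, ← Kernel.map_apply _ (by fun_prop), Kernel.traj_map_frestrictLe]
  have hKg : Measurable fun y => ∫⁻ z, g z ∂(K y) := hg.lintegral_kernel
  have hFg : Measurable fun p : (Finset.Iic n → X) × X => F p.1 * g p.2 := by fun_prop
  have hFK : Measurable fun p : Finset.Iic n → X =>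
      F p * ∫⁻ z, g z ∂(K (p ⟨n, Finset.mem_Iic.2 le_rfl⟩)) :=
    hF.mul (hKg.comp (measurable_pi_apply _))
  calc _ = ∫⁻ p, F p.1 * g p.2 ∂((chainLaw K x).map
          (fun ω => (Preorder.frestrictLe n ω, ω (n + 1)))) := by
        rw [lintegral_map hFg (by fun_prop)]
    _ = ∫⁻ p, F p * ∫⁻ z, g z ∂(K (p ⟨n, Finset.mem_Iic.2 le_rfl⟩))
          ∂((chainLaw K x).map (Preorder.frestrictLe n)) := by
        rw [hm, chainLaw, ← h, Measure.lintegral_compProd hFg]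
        refine lintegral_congr fun p => ?_
        change ∫⁻ y, F p * g y ∂(K (p ⟨n, Finset.mem_Iic.2 le_rfl⟩)) = _
        rw [lintegral_const_mul _ hg]
    _ = _ := by rw [lintegral_map hFK (by fun_prop)]; rfl

lemma lintegral_chainLaw_prod_succ (K : Kernel X X) [IsMarkovKernel K] (x : X) (n : ℕ)
    {f : ℕ → X → ℝ≥0∞} (hf : ∀ n, Measurable (f n)) :
    ∫⁻ ω, (∏ j ∈ Finset.range (n + 1), f j (ω j)) * f (n + 1) (ω (n + 1)) ∂(chainLaw K x)
      = ∫⁻ ω, (∏ j ∈ Finset.range (n + 1), f j (ω j)) * (∫⁻ y, f (n + 1) y ∂(K (ω n)))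
        ∂(chainLaw K x) := by
  have hF : Measurable fun p : Finset.Iic n → X => ∏ j ∈ (Finset.range (n + 1)).attach,
      f j (p ⟨j, Finset.mem_Iic.2 (Nat.lt_succ_iff.1 (Finset.mem_range.1 j.2))⟩) :=
    Finset.measurable_prod _ fun j _ => (hf j).comp (measurable_pi_apply _)
  have h := lintegral_chainLaw_succ K x n hF (hf (n + 1))
  have e : ∀ ω : ℕ → X, ∏ j ∈ (Finset.range (n + 1)).attach,
      f j ((Preorder.frestrictLe n ω : Finset.Iic n → X)
        ⟨j, Finset.mem_Iic.2 (Nat.lt_succ_iff.1 (Finset.mem_range.1 j.2))⟩)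
      = ∏ j ∈ Finset.range (n + 1), f j (ω j) := fun ω =>
    Finset.prod_attach (Finset.range (n + 1)) fun j => f j (ω j)
  simpa only [e] using h

/-- Conditioning a finite-dimensional functional on the first step. -/
lemma lintegral_chainLaw_prod (K : Kernel X X) [IsMarkovKernel K] (x : X) (n : ℕ)
    {f : ℕ → X → ℝ≥0∞} (hf : ∀ n, Measurable (f n)) :
    ∫⁻ ω, ∏ j ∈ Finset.range (n + 2), f j (ω j) ∂(chainLaw K x)
      = f 0 x * ∫⁻ y, ∫⁻ ω, ∏ j ∈ Finset.range (n + 1), f (j + 1) (ω j) ∂(chainLaw K y)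
        ∂(K x) := by
  induction n generalizing f with
  | zero =>
    simp_rw [Finset.prod_range_succ _ 1]
    rw [lintegral_chainLaw_prod_succ K x 0 hf]
    have := lintegral_chainLaw_zero K x ((hf 0).mul ((hf 1).lintegral_kernel (κ := K)))
    simp only [Pi.mul_apply] at this
    simp [lintegral_chainLaw_zero K _ (hf 1), this]
  | succ n ih =>
    have hK : Measurable fun y => ∫⁻ z, f (n + 2) z ∂(K y) := (hf (n + 2)).lintegral_kernel
    -- The last time is integrated out and its factor absorbed into the factor at time `n + 1`. This
    -- leaves a product one factor shorter, to which the induction hypothesis applies.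
    set f' : ℕ → X → ℝ≥0∞ :=
      Function.update f (n + 1) (fun y => f (n + 1) y * ∫⁻ z, f (n + 2) z ∂(K y)) with hf'
    have hne : ∀ j, j ≠ n + 1 → f' j = f j := fun j hj => by simp [hf', hj]
    have he : ∀ y, f' (n + 1) y = f (n + 1) y * ∫⁻ z, f (n + 2) z ∂(K y) := by simp [hf']
    have hm : ∀ j, Measurable (f' j) := fun j => by
      by_cases hj : j = n + 1
      · subst hj
        rw [hf', Function.update_self]
        exact (hf _).mul hK
      · rw [hne j hj]; exact hf j
    have h1 : ∫⁻ ω, ∏ j ∈ Finset.range (n + 1 + 2), f j (ω j) ∂(chainLaw K x)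
        = ∫⁻ ω, ∏ j ∈ Finset.range (n + 2), f' j (ω j) ∂(chainLaw K x) := by
      simp_rw [Finset.prod_range_succ _ (n + 2)]
      rw [lintegral_chainLaw_prod_succ K x (n + 1) hf]
      refine lintegral_congr fun ω => ?_
      rw [Finset.prod_range_succ, Finset.prod_range_succ _ (n + 1), he, mul_assoc]
      congr 1
      refine Finset.prod_congr rfl fun j hj => ?_
      rw [hne j (Finset.mem_range.1 hj).ne]
    rw [h1, ih hm, hne 0 (by omega)]
    congr 1
    refine lintegral_congr fun y => ?_
    simp_rw [Finset.prod_range_succ _ (n + 1)]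
    rw [lintegral_chainLaw_prod_succ K y n (f := fun j => f (j + 1)) fun j => hf (j + 1)]
    refine lintegral_congr fun ω => ?_
    rw [Finset.prod_range_succ, Finset.prod_range_succ _ n, he, mul_assoc]
    congr 1
    refine Finset.prod_congr rfl fun j hj => ?_
    rw [hne _ (by have := Finset.mem_range.1 hj; omega)]

lemma measurable_shift : Measurable fun (ω : ℕ → X) n => ω (n + 1) := by fun_prop

lemma measurableSet_box {t : ℕ → Set X} (ht : ∀ j, MeasurableSet (t j)) (n : ℕ) :
    MeasurableSet {ω : ℕ → X | ∀ j < n, ω j ∈ t j} := by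
  simp only [Set.ofPred_forall]
  exact .iInter fun j => .iInter fun _ => ht j |>.preimage (measurable_pi_apply j)

lemma chainLaw_box (K : Kernel X X) [IsMarkovKernel K] (x : X) (n : ℕ) {t : ℕ → Set X}
    (ht : ∀ j, MeasurableSet (t j)) :
    chainLaw K x {ω | ∀ j < n, ω j ∈ t j}
      = ∫⁻ ω, ∏ j ∈ Finset.range n, (t j).indicator 1 (ω j) ∂(chainLaw K x) := by
  rw [← lintegral_indicator_one (measurableSet_box ht n)]
  refine lintegral_congr fun ω => ?_
  by_cases h : ∀ j < n, ω j ∈ t j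
  · rw [Set.indicator_of_mem (by exact h), Finset.prod_eq_one]
    · rfl
    · intro j hj
      rw [Set.indicator_of_mem (h j (Finset.mem_range.1 hj))]; rfl
  · rw [Set.indicator_of_notMem (by exact h)]
    push Not at h
    obtain ⟨j, hj, hω⟩ := h
    rw [Finset.prod_eq_zero (Finset.mem_range.2 hj)]
    rw [Set.indicator_of_notMem hω]

/-- The Markov property: after one step the chain starts afresh. -/
theorem chainLaw_map_shift (K : Kernel X X) [IsMarkovKernel K] (x : X) :
    (chainLaw K x).map (fun ω n => ω (n + 1)) = (K x).bind (chainLaw K) := by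
  have hsub : ∀ (s : Set (ℕ → X)), MeasurableSet s →
      (K x).bind (chainLaw K) s = ∫⁻ y, chainLaw K y s ∂(K x) := fun s hs =>
    Measure.bind_apply hs (measurable_chainLaw K).aemeasurable
  have : IsProbabilityMeasure ((chainLaw K x).map fun ω n => ω (n + 1)) :=
    Measure.isProbabilityMeasure_map measurable_shift.aemeasurable
  refine ext_of_generate_finite _ (generateFrom_squareCylinders (α := fun _ : ℕ => X)).symm
    (isPiSystem_squareCylinders (fun _ => MeasurableSpace.isPiSystem_measurableSet)
      fun _ => .univ) ?_ ?_
  · rintro _ ⟨S, t, ht, rfl⟩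
    set t' : ℕ → Set X := fun j => if j ∈ S then t j else Set.univ with ht'
    have hmt : ∀ j, MeasurableSet (t' j) := fun j => by
      simp only [ht']
      split_ifs
      · exact ht j (Set.mem_univ j)
      · exact .univ
    -- All constrained times are at most `n`, so the cylinder is a box over times `0, …, n`, with
    -- `Set.univ` at the unconstrained times.
    set n := S.sup id
    have hpi : (S : Set ℕ).pi t = {ω : ℕ → X | ∀ j < n + 1, ω j ∈ t' j} := by
      ext ω
      simp only [Set.mem_pi, Finset.mem_coe, Set.mem_ofPred_eq, ht']
      constructor
      · intro h j _
        split_ifs with hj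
        · exact h j hj
        · trivial
      · intro h j hj
        have := h j (Nat.lt_succ_of_le (Finset.le_sup (f := id) hj))
        rwa [if_pos hj] at this
    have hms : MeasurableSet {ω : ℕ → X | ∀ j < n + 1, ω j ∈ t' j} := measurableSet_box hmt _
    -- The preimage of the box under the shift is a box with one more side: time `0` is free and
    -- side `j` moves to time `j + 1`.
    have hT : ∀ j, MeasurableSet ((fun j => Nat.casesOn j Set.univ t' : ℕ → Set X) j) := by
      rintro (_ | j)
      · exact .univ
      · exact hmt j
    have e : (fun (ω : ℕ → X) n => ω (n + 1)) ⁻¹' {ω | ∀ j < n + 1, ω j ∈ t' j}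
        = {ω | ∀ j < n + 2, ω j ∈ (fun j => Nat.casesOn j Set.univ t' : ℕ → Set X) j} := by
      ext ω
      simp only [Set.mem_preimage, Set.mem_ofPred_eq]
      constructor
      · rintro h (_ | j) hj
        · trivial
        · exact h j (by omega)
      · intro h j hj
        exact h (j + 1) (by omega)
    simp only [hpi]
    rw [hsub _ hms, Measure.map_apply measurable_shift hms, e, chainLaw_box K x _ hT,
      lintegral_chainLaw_prod K x n
        (f := fun j => ((fun j => Nat.casesOn j Set.univ t' : ℕ → Set X) j).indicator 1)
        fun j => measurable_one.indicator (hT j)]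
    change Set.univ.indicator 1 x * _ = _
    rw [Set.indicator_univ, Pi.one_apply, one_mul]
    exact lintegral_congr fun y => (chainLaw_box K y _ hmt).symm
  · rw [hsub _ .univ]; simp

lemma chainLaw_shift_preimage (K : Kernel X X) [IsMarkovKernel K] (x : X) {s : Set (ℕ → X)}
    (hs : MeasurableSet s) :
    chainLaw K x ((fun ω n => ω (n + 1)) ⁻¹' s) = ∫⁻ y, chainLaw K y s ∂(K x) := by
  rw [← Measure.map_apply measurable_shift hs, chainLaw_map_shift,
    Measure.bind_apply hs (measurable_chainLaw K).aemeasurable]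

end Trajectories

/-! ### Recurrence from almost every starting point. -/

section Recurrence

variable {X : Type*} [MeasurableSpace X]

lemma measurableSet_hit {A : Set X} (hA : MeasurableSet A) (m : ℕ) :
    MeasurableSet {ω : ℕ → X | ∃ n ≥ m, ω n ∈ A} := by
  simp only [Set.ofPred_exists, Set.ofPred_and]
  exact .iUnion fun n => .inter (.const _) (hA.preimage (measurable_pi_apply n))

lemma setOf_frequently_mem {X : Type*} (A : Set X) :
    {ω : ℕ → X | ∃ᶠ n in atTop, ω n ∈ A} = ⋂ m, {ω : ℕ → X | ∃ n ≥ m, ω n ∈ A} := by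
  ext ω; simp [frequently_atTop]

/-- The probability of visiting `A` only finitely often. -/
def transience (K : Kernel X X) [IsMarkovKernel K] (A : Set X) (x : X) : ℝ≥0∞ :=
  chainLaw K x {ω | ∃ᶠ n in atTop, ω n ∈ A}ᶜ

variable {K : Kernel X X} [IsMarkovKernel K] {A : Set X} {π : Measure X}

lemma measurableSet_frequently (hA : MeasurableSet A) :
    MeasurableSet {ω : ℕ → X | ∃ᶠ n in atTop, ω n ∈ A} := by
  rw [setOf_frequently_mem]
  exact .iInter fun m => measurableSet_hit hA m

lemma measurable_transience (hA : MeasurableSet A) : Measurable (transience K A) :=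
  (chainKernel K).measurable_coe (measurableSet_frequently hA).compl

/-- Visiting `A` infinitely often is a shift-invariant event, so by the Markov property its
complement has a harmonic probability. -/
lemma transience_eq_lintegral (hA : MeasurableSet A) (x : X) :
    transience K A x = ∫⁻ y, transience K A y ∂(K x) := by
  unfold transience
  rw [← chainLaw_shift_preimage K x (measurableSet_frequently hA).compl]
  congr 1
  ext ω
  simp only [Set.mem_compl_iff, Set.mem_ofPred_eq, Set.mem_preimage, not_iff_not]
  conv_lhs => rw [← map_add_atTop_eq_nat 1, frequently_map]

lemma transience_eq_lintegral_pow (hA : MeasurableSet A) (n : ℕ) (x : X) :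
    transience K A x = ∫⁻ y, transience K A y ∂((K ^ n) x) := by
  induction n with
  | zero =>
    have : (K ^ 0) x = Measure.dirac x := Kernel.id_apply x
    rw [this, lintegral_dirac' _ (measurable_transience hA)]
  | succ n ih =>
    have : (K ^ (n + 1)) x = ((K ^ n) x).bind K := by
      rw [pow_succ']; exact Kernel.comp_apply _ _ _
    rw [this, Measure.lintegral_bind K.measurable.aemeasurable
      (measurable_transience hA).aemeasurable, ih]
    exact lintegral_congr fun y => transience_eq_lintegral hA y

/-- Under the invariant initial law the trajectory is stationary, so delaying the time from which
visits are counted does not change the probability of a visit. -/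
lemma lintegral_hit_eq [IsProbabilityMeasure π] (hinv : K.Invariant π) (hA : MeasurableSet A)
    (m : ℕ) :
    ∫⁻ x, chainLaw K x {ω | ∃ n ≥ m, ω n ∈ A} ∂π
      = ∫⁻ x, chainLaw K x {ω | ∃ n ≥ 0, ω n ∈ A} ∂π := by
  induction m with
  | zero => rfl
  | succ m ih =>
    have hw : Measurable fun x => chainLaw K x {ω | ∃ n ≥ m, ω n ∈ A} :=
      (chainKernel K).measurable_coe (measurableSet_hit hA m)
    have e : {ω : ℕ → X | ∃ n ≥ m + 1, ω n ∈ A}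
        = (fun ω n => ω (n + 1)) ⁻¹' {ω | ∃ n ≥ m, ω n ∈ A} := by
      ext ω
      simp only [Set.mem_preimage, Set.mem_ofPred_eq]
      constructor
      · rintro ⟨n, hn, h⟩
        obtain ⟨n, rfl⟩ : ∃ j, n = j + 1 := ⟨n - 1, by omega⟩
        exact ⟨n, by omega, h⟩
      · rintro ⟨n, hn, h⟩
        exact ⟨n + 1, by omega, h⟩
    simp_rw [e, chainLaw_shift_preimage K _ (measurableSet_hit hA m)]
    rw [← Measure.lintegral_bind K.measurable.aemeasurable hw.aemeasurable, hinv.def, ih]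

/-- Poincaré recurrence: the probability of a visit after time `m` decreases in `m` but has constant
mean, so it is almost everywhere constant in `m`. On `A` it equals `1`. -/
lemma ae_transience_eq_zero_of_mem [IsProbabilityMeasure π] (hinv : K.Invariant π)
    (hA : MeasurableSet A) : ∀ᵐ x ∂π, x ∈ A → transience K A x = 0 := by
  have hw : ∀ m, Measurable fun x => chainLaw K x {ω | ∃ n ≥ m, ω n ∈ A} := fun m =>
    (chainKernel K).measurable_coe (measurableSet_hit hA m)
  have hae : ∀ m, (fun x => chainLaw K x {ω | ∃ n ≥ m, ω n ∈ A})
      =ᵐ[π] fun x => chainLaw K x {ω | ∃ n ≥ 0, ω n ∈ A} := fun m => by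
    refine ae_eq_of_ae_le_of_lintegral_le (.of_forall fun x => measure_mono ?_) ?_
      (hw 0).aemeasurable (lintegral_hit_eq hinv hA m).ge
    · rintro ω ⟨n, -, h⟩; exact ⟨n, Nat.zero_le n, h⟩
    · refine ((lintegral_mono fun x => prob_le_one).trans_lt ?_).ne
      simp
  filter_upwards [ae_all_iff.2 hae] with x hx hxA
  -- Time `0` counts as a visit, so a chain started in `A` hits `A` surely.
  have h0 : chainLaw K x {ω | ∃ n ≥ 0, ω n ∈ A} = 1 := by
    refine le_antisymm prob_le_one ?_
    have h := lintegral_chainLaw_zero K x (measurable_one.indicator hA : Measurable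
      (A.indicator (1 : X → ℝ≥0∞)))
    rw [Set.indicator_of_mem hxA, Pi.one_apply] at h
    rw [← h, ← lintegral_indicator_one (measurableSet_hit hA 0)]
    refine lintegral_mono fun ω => ?_
    by_cases hω : ω 0 ∈ A
    · rw [Set.indicator_of_mem hω, Set.indicator_of_mem (by exact ⟨0, le_rfl, hω⟩)]
      simp
    · rw [Set.indicator_of_notMem hω]; exact zero_le
  unfold transience
  rw [prob_compl_eq_zero_iff (measurableSet_frequently hA), setOf_frequently_mem,
    Antitone.measure_iInter _ (fun m => (measurableSet_hit hA m).nullMeasurableSet)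
      ⟨0, measure_ne_top _ _⟩]
  · simp_rw [hx, h0]; simp
  · rintro a b hab ω ⟨n, hn, h⟩; exact ⟨n, hab.trans hn, h⟩

/-- An irreducible chain with an invariant probability measure visits every set of positive
measure infinitely often, from almost every starting point. -/
theorem ae_transience_eq_zero [IsProbabilityMeasure π] (hinv : K.Invariant π)
    (hirr : K.IsIrreducible π) (hA : MeasurableSet A) (hπA : 0 < π A) :
    ∀ᵐ x ∂π, transience K A x = 0 := by
  have hmeas : MeasurableSet {x | transience K A x ≠ 0} :=
    (measurable_transience hA (measurableSet_singleton 0)).compl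
  obtain ⟨x, hxA, hx⟩ : ∃ x, x ∈ A ∧ transience K A x = 0 := by
    by_contra! h
    refine hπA.ne' (measure_mono_null (fun x hx => ?_)
      (ae_iff.1 (ae_transience_eq_zero_of_mem hinv hA)))
    exact fun h' => h x hx (h' hx)
  rw [ae_iff]
  by_contra hpos
  -- If the bad set had positive measure, it would be reached from the good point `x` in some `n`
  -- steps with positive probability. Harmonicity for `K ^ n` would then make the transience at `x`
  -- positive.
  obtain ⟨n, hn⟩ := hirr.irreducible hmeas (pos_iff_ne_zero.2 hpos) x
  rw [transience_eq_lintegral_pow hA n, lintegral_eq_zero_iff (measurable_transience hA)] at hx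
  exact hn.ne' (ae_iff.1 hx)

end Recurrence

/-! ### Transfer of Harris ergodicity to a dominating kernel. -/

section Minorization

variable {X : Type*} [MeasurableSpace X] {K L : Kernel X X} {π : Measure X} {c : ℝ≥0∞}

lemma smul_pow_le_pow (h : ∀ x, c • K x ≤ L x) (n : ℕ) (x : X) :
    c ^ n • (K ^ n) x ≤ (L ^ n) x := by
  induction n with
  | zero => simp
  | succ n ih =>
    refine Measure.le_iff.2 fun s hs => ?_
    rw [Measure.smul_apply, Kernel.pow_succ_apply_eq_lintegral _ _ _ hs,
      Kernel.pow_succ_apply_eq_lintegral _ _ _ hs]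
    calc c ^ (n + 1) • ∫⁻ b, K b s ∂((K ^ n) x)
        = ∫⁻ b, c * K b s ∂(c ^ n • (K ^ n) x) := by
          rw [lintegral_smul_measure, lintegral_const_mul _ (K.measurable_coe hs), smul_eq_mul,
            smul_eq_mul, pow_succ, mul_assoc]
      _ ≤ ∫⁻ b, L b s ∂((L ^ n) x) := lintegral_mono' ih fun b => h b s

lemma isIrreducible_of_smul_le (hc : c ≠ 0) (h : ∀ x, c • K x ≤ L x) (hK : K.IsIrreducible π) :
    L.IsIrreducible π where
  irreducible A hA hπ x := by
    obtain ⟨n, hn⟩ := hK.irreducible hA hπ x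
    exact ⟨n, (ENNReal.mul_pos (pow_ne_zero n hc) hn.ne').trans_le (smul_pow_le_pow h n x A)⟩

variable [IsMarkovKernel K] [IsMarkovKernel L]

/-- Null sets of `L x` are null for `K x`, so a cycle of `L` is also a cycle of `K`. -/
lemma isAperiodicChain_of_smul_le (hc : c ≠ 0) (h : ∀ x, c • K x ≤ L x)
    (hK : IsAperiodicChain K π) : IsAperiodicChain L π := by
  rintro ⟨d, E, hd, hE, hdisj, hpos, hcyc⟩
  refine hK ⟨d, E, hd, hE, hdisj, hpos, fun i x hx => ?_⟩
  have h1 := hcyc i x hx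
  rw [← prob_compl_eq_zero_iff (hE _)] at h1 ⊢
  have h2 : c * K x (E (i + 1))ᶜ ≤ 0 := (h x _).trans h1.le
  exact (mul_eq_zero.1 (le_antisymm h2 zero_le)).resolve_left hc

/-- From any point, one step of `L` lands in the zero set of the transience with probability at
least `c`. This contracts the supremum of that harmonic function. Only `K x`, not `L x`, has to be
absolutely continuous, which matters because `L` may keep old blocks. -/
lemma isHarrisRecurrent_of_smul_le [IsProbabilityMeasure π] (hc : c ≠ 0)
    (h : ∀ x, c • K x ≤ L x) (hac : ∀ x, K x ≪ π) (hinv : L.Invariant π)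
    (hirr : L.IsIrreducible π) : IsHarrisRecurrent L π := by
  intro A hA hπA
  have hu := measurable_transience (K := L) hA
  have h0 := ae_transience_eq_zero hinv hirr hA hπA
  have hZ : MeasurableSet {x | transience L A x = 0} := hu (measurableSet_singleton 0)
  set s := ⨆ x, transience L A x with hs
  have hs1 : s ≤ 1 := iSup_le fun x => prob_le_one
  have hle : s ≤ s * (1 - c) := iSup_le fun x => by
    have hKZ : K x {x | transience L A x = 0} = 1 :=
      (prob_compl_eq_zero_iff hZ).1 (hac x (ae_iff.1 h0))
    calc transience L A x = ∫⁻ y, transience L A y ∂(L x) := transience_eq_lintegral hA x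
      _ ≤ ∫⁻ y, {x | transience L A x = 0}ᶜ.indicator (fun _ => s) y ∂(L x) :=
          lintegral_mono fun y => by
            by_cases hy : transience L A y = 0
            · simp [hy]
            · rw [Set.indicator_of_mem (by exact hy)]; exact le_iSup (transience L A) y
      _ = s * L x {x | transience L A x = 0}ᶜ := lintegral_indicator_const hZ.compl s
      _ ≤ s * (1 - c) := by
          gcongr
          rw [prob_compl_eq_one_sub hZ]
          gcongr
          calc c = c * K x {x | transience L A x = 0} := by rw [hKZ, mul_one]
            _ ≤ _ := h x _
  have hs0 : s = 0 := by
    by_contra hne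
    have hlt : 1 - c < 1 := ENNReal.sub_lt_self ENNReal.one_ne_top one_ne_zero hc
    -- Strictness requires `s` to be finite as well as nonzero; `s ≤ 1` provides this.
    have := ENNReal.mul_lt_mul_right hne (hs1.trans_lt ENNReal.one_lt_top).ne hlt
    rw [mul_one] at this
    exact absurd hle this.not_ge
  intro x
  exact le_antisymm ((le_iSup (transience L A) x).trans_eq hs0) zero_le

/-- A Markov chain with invariant probability measure `π` whose kernel dominates a multiple of a
Harris ergodic kernel with transition probabilities absolutely continuous with respect to `π` is
Harris ergodic. -/
theorem IsHarrisErgodic.of_smul_le (hc : c ≠ 0) (h : ∀ x, c • K x ≤ L x) (hac : ∀ x, K x ≪ π)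
    (hinv : L.Invariant π) (hK : IsHarrisErgodic K π) : IsHarrisErgodic L π :=
  have := hK.isProbabilityMeasure
  have hirr := isIrreducible_of_smul_le hc h hK.irreducible
  ⟨this, hinv, hirr, isAperiodicChain_of_smul_le hc h hK.aperiodic,
    isHarrisRecurrent_of_smul_le hc h hac hinv hirr⟩

end Minorization

/-! ### Product densities. -/

section PiDensity

/-- Tonelli's theorem for a product of functions of one coordinate each. -/
theorem lintegral_fin_prod_eq_prod {n : ℕ} {E : Fin n → Type*} [∀ i, MeasurableSpace (E i)]
    (μ : (i : Fin n) → Measure (E i)) [∀ i, SigmaFinite (μ i)] {f : (i : Fin n) → E i → ℝ≥0∞}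
    (hf : ∀ i, Measurable (f i)) :
    ∫⁻ x, ∏ i, f i (x i) ∂(Measure.pi μ) = ∏ i, ∫⁻ x, f i x ∂(μ i) := by
  induction n with
  | zero => simp
  | succ n ih =>
    have hm : Measurable fun x : (i : Fin n) → E i.succ => ∏ i, f i.succ (x i) :=
      Finset.measurable_prod _ fun i _ => (hf _).comp (measurable_pi_apply i)
    have hF : Measurable fun x : E 0 × ((i : Fin n) → E i.succ) =>
        f 0 x.1 * ∏ i, f i.succ (x.2 i) :=
      ((hf 0).comp measurable_fst).mul (hm.comp measurable_snd)
    calc ∫⁻ x, ∏ i, f i (x i) ∂(Measure.pi μ)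
        = ∫⁻ x : E 0 × ((i : Fin n) → E i.succ), f 0 x.1 * ∏ i, f i.succ (x.2 i)
            ∂((μ 0).prod (Measure.pi fun i => μ i.succ)) := by
          have h := (measurePreserving_piFinSuccAbove μ 0).lintegral_comp hF
          refine Eq.trans (lintegral_congr fun x => ?_) h
          rw [Fin.prod_univ_succ]
          rfl
      _ = _ := by
          rw [lintegral_prod_mul (hf 0).aemeasurable hm.aemeasurable, Fin.prod_univ_succ,
            ih (fun i => μ i.succ) fun i => hf _]

/-- A product of probability measures with densities has the product density. -/
theorem pi_withDensity {n : ℕ} {E : Fin n → Type*} [∀ i, MeasurableSpace (E i)]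
    (μ : (i : Fin n) → Measure (E i)) [∀ i, SigmaFinite (μ i)] {f : (i : Fin n) → E i → ℝ≥0∞}
    (hf : ∀ i, Measurable (f i)) [∀ i, SigmaFinite ((μ i).withDensity (f i))] :
    Measure.pi (fun i => (μ i).withDensity (f i))
      = (Measure.pi μ).withDensity fun x => ∏ i, f i (x i) := by
  refine Measure.pi_eq fun s hs => ?_
  have h : (Set.univ.pi s).indicator (fun x => ∏ i, f i (x i))
      = fun x : (i : Fin n) → E i => ∏ i, (s i).indicator (f i) (x i) := by
    ext x
    by_cases hx : x ∈ Set.univ.pi s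
    · rw [Set.indicator_of_mem hx]
      exact Finset.prod_congr rfl fun i _ => (Set.indicator_of_mem (hx i trivial) _).symm
    · rw [Set.indicator_of_notMem hx]
      obtain ⟨i, hi⟩ : ∃ i, x i ∉ s i := by simpa using hx
      exact (Finset.prod_eq_zero (Finset.mem_univ i) (Set.indicator_of_notMem hi _)).symm
  rw [withDensity_apply _ (.univ_pi hs), ← lintegral_indicator (.univ_pi hs), h,
    lintegral_fin_prod_eq_prod μ fun i => (hf i).indicator (hs i)]
  refine Finset.prod_congr rfl fun i _ => ?_
  rw [lintegral_indicator (hs i), withDensity_apply _ (hs i)]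

end PiDensity

/-! ### Invariance of the posterior and domination of the parent kernel. -/

namespace DAModel

variable {k : ℕ} {M : Fin k → Type*} [∀ i, MeasurableSpace (M i)] {Θ : Type*} [MeasurableSpace Θ]
  {μ : (i : Fin k) → Measure (M i)} {ν : Measure Θ} (m : DAModel μ ν)
  {r : ℝ} (q : FractionRule k Θ r) (ε : Set.Icc (0 : ℝ) 1)

lemma paramKernel_apply [SigmaFinite ν] (D : (i : Fin k) → M i) :
    m.paramKernel D = ν.withDensity (m.param D) := by
  rw [paramKernel, Kernel.withDensity_apply _ m.measurable_param, Kernel.const_apply]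

/-- The first marginal of the posterior followed by the P step is the posterior. -/
lemma posterior_fst_bind_pStep [SigmaFinite ν] : m.posterior.fst.bind m.pStep = m.posterior := by
  ext s hs
  have hp : Measurable fun D => m.pStep D s := m.pStep.measurable_coe hs
  have hd : Measurable fun D => ∫⁻ θ, m.joint (D, θ) ∂ν := m.measurable_joint.lintegral_prod_right'
  have hi : Measurable fun x => s.indicator (fun _ => (1 : ℝ≥0∞)) x := measurable_const.indicator hs
  have hpm : Measurable fun x : ((i : Fin k) → M i) × Θ => m.param x.1 x.2 := m.measurable_param
  have hstep : ∀ D, m.pStep D s = ∫⁻ θ, m.param D θ * s.indicator (fun _ => 1) (D, θ) ∂ν := by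
    intro D
    have hiD : Measurable fun θ => s.indicator (fun _ => (1 : ℝ≥0∞)) (D, θ) :=
      hi.comp measurable_prodMk_left
    rw [← lintegral_indicator_one hs, pStep, Kernel.lintegral_id_prod (measurable_one.indicator hs),
      paramKernel_apply]
    exact lintegral_withDensity_eq_lintegral_mul _ m.measurable_param.of_uncurry_left hiD
  rw [Measure.bind_apply hs m.pStep.measurable.aemeasurable, Measure.fst,
    lintegral_map hp measurable_fst]
  have hcomp : Measurable fun x : ((i : Fin k) → M i) × Θ => m.pStep x.1 s :=
    hp.comp measurable_fst
  rw [posterior,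
    lintegral_withDensity_eq_lintegral_mul _ m.measurable_joint hcomp,
    withDensity_apply _ hs, ← lintegral_indicator hs]
  have h : s.indicator m.joint =ᵐ[(Measure.pi μ).prod ν] fun x =>
      (∫⁻ θ, m.joint (x.1, θ) ∂ν) * (m.param x.1 x.2 * s.indicator (fun _ => 1) x) := by
    filter_upwards [m.joint_eq_param] with x hx
    by_cases hxs : x ∈ s
    · rw [Set.indicator_of_mem hxs, Set.indicator_of_mem hxs, hx, mul_one, mul_comm]
    · simp [Set.indicator_of_notMem hxs]
  rw [lintegral_congr_ae h, lintegral_prod _ (m.measurable_joint.mul hcomp).aemeasurable]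
  refine Eq.trans ?_ (lintegral_prod _
    ((hd.comp measurable_fst).mul (hpm.mul hi)).aemeasurable).symm
  refine lintegral_congr fun D => ?_
  have h1 : Measurable fun θ => m.joint (D, θ) := m.measurable_joint.comp measurable_prodMk_left
  have h2 : Measurable fun θ => m.param D θ * s.indicator (fun _ => (1 : ℝ≥0∞)) (D, θ) :=
    (hpm.mul hi).comp measurable_prodMk_left
  simp only [Pi.mul_apply, Function.comp_apply]
  rw [lintegral_mul_const _ h1, lintegral_const_mul _ h2, hstep]

variable [∀ i, SigmaFinite (μ i)]

lemma blockKernel_apply (i : Fin k) (θ : Θ) :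
    m.blockKernel i θ = (μ i).withDensity (m.block i θ) := by
  rw [blockKernel, Kernel.withDensity_apply _ (m.measurable_block i), Kernel.const_apply]

lemma blockUpdate_of_mem {S : Finset (Fin k)} {i : Fin k} (hi : i ∈ S)
    (x : ((i : Fin k) → M i) × Θ) : m.blockUpdate S i x = m.blockKernel i x.2 := by
  rw [blockUpdate, if_pos hi]; rfl

lemma blockUpdate_of_notMem {S : Finset (Fin k)} {i : Fin k} (hi : i ∉ S)
    (x : ((i : Fin k) → M i) × Θ) : m.blockUpdate S i x = Measure.dirac (x.1 i) := by
  rw [blockUpdate, if_neg hi, Kernel.deterministic_apply]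

/-- Connects independent sampling of the blocks with the product density in `joint_eq_block`. -/
lemma piKernel_blockKernel_apply (θ : Θ) :
    piKernel m.blockKernel θ = (Measure.pi μ).withDensity fun D => ∏ i, m.block i θ (D i) := by
  have hb : ∀ i, Measurable (m.block i θ) := fun i => (m.measurable_block i).of_uncurry_left
  have : ∀ i, IsProbabilityMeasure ((μ i).withDensity (m.block i θ)) := fun i => by
    rw [← blockKernel_apply]; infer_instance
  rw [← pi_withDensity μ hb]
  change Measure.pi _ = _
  simp_rw [blockKernel_apply]

lemma adIStep_apply (x : ((i : Fin k) → M i) × Θ) :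
    m.adIStep q ε x = ENNReal.ofReal ε • m.subsetIStep Finset.univ x
      + ENNReal.ofReal (1 - ε) • m.fractionIStep q x := by
  rw [adIStep, add_apply, Kernel.withDensity_apply _ measurable_const,
    Kernel.withDensity_apply _ measurable_const, withDensity_const, withDensity_const]

lemma fractionIStep_apply' (x : ((i : Fin k) → M i) × Θ) (s : Set ((i : Fin k) → M i)) :
    m.fractionIStep q x s = ∑ S, q.prob S x.2 * m.subsetIStep S x s := by
  rw [fractionIStep, Kernel.finsetSum_apply']
  refine Finset.sum_congr rfl fun S _ => ?_
  have h : Measurable (Function.uncurry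
      fun (x : ((i : Fin k) → M i) × Θ) (_ : (i : Fin k) → M i) => q.prob S x.2) :=
    (q.measurable_prob S).comp (measurable_snd.comp measurable_fst)
  rw [Kernel.withDensity_apply _ h, withDensity_const, Measure.smul_apply, smul_eq_mul]

/-- Redrawing a subset of the blocks preserves their conditional law given the parameter. -/
lemma lintegral_subsetIStep (S : Finset (Fin k)) (θ : Θ) {s : Set ((i : Fin k) → M i)}
    (hs : MeasurableSet s) :
    ∫⁻ D, m.subsetIStep S (D, θ) s ∂(piKernel m.blockKernel θ) = piKernel m.blockKernel θ s := by
  set κ : Kernel ((i : Fin k) → M i) ((i : Fin k) → M i) :=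
    (m.subsetIStep S).comap (fun D => (D, θ)) measurable_prodMk_right with hκ
  have hbind : ∀ {t}, MeasurableSet t → (piKernel m.blockKernel θ).bind κ t
      = ∫⁻ D, m.subsetIStep S (D, θ) t ∂(piKernel m.blockKernel θ) := fun ht =>
    Measure.bind_apply ht κ.measurable.aemeasurable
  rw [← hbind hs]
  have hpi : piKernel m.blockKernel θ = Measure.pi fun i => m.blockKernel i θ := rfl
  suffices h : Measure.pi (fun i => m.blockKernel i θ) = (piKernel m.blockKernel θ).bind κ by
    rw [← h, hpi]
  refine Measure.pi_eq fun t ht => ?_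
  rw [hbind (.univ_pi ht)]
  -- On a rectangle the update probability factors over the blocks: a constant for a redrawn block,
  -- an indicator for a kept one. Both have the same mean under `m.blockKernel i θ`.
  have hf : ∀ i, Measurable fun y : M i =>
      if i ∈ S then m.blockKernel i θ (t i) else (t i).indicator 1 y := fun i => by
    split_ifs
    · exact measurable_const
    · exact measurable_one.indicator (ht i)
  have hu : ∀ D : (i : Fin k) → M i, m.subsetIStep S (D, θ) (Set.univ.pi t)
      = ∏ i, if i ∈ S then m.blockKernel i θ (t i) else (t i).indicator 1 (D i) := by
    intro D
    change Measure.pi (fun i => m.blockUpdate S i (D, θ)) _ = _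
    rw [Measure.pi_pi]
    refine Finset.prod_congr rfl fun i _ => ?_
    split_ifs with hi
    · rw [blockUpdate_of_mem m hi]
    · rw [blockUpdate_of_notMem m hi, Measure.dirac_apply' _ (ht i)]
  simp_rw [hu]
  rw [hpi, lintegral_fin_prod_eq_prod (fun i => m.blockKernel i θ) hf]
  refine Finset.prod_congr rfl fun i _ => ?_
  split_ifs with hi
  · simp
  · rw [lintegral_indicator_one (ht i)]

variable [SigmaFinite ν]

/-- Integration against the posterior by conditioning on the parameter. -/
lemma lintegral_posterior_eq_block {F : ((i : Fin k) → M i) × Θ → ℝ≥0∞} (hF : Measurable F) :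
    ∫⁻ x, F x ∂m.posterior
      = ∫⁻ θ, (∫⁻ D, m.joint (D, θ) ∂(Measure.pi μ))
          * ∫⁻ D, F (D, θ) ∂(piKernel m.blockKernel θ) ∂ν := by
  have hb : Measurable fun x : ((i : Fin k) → M i) × Θ => ∏ i, m.block i x.2 (x.1 i) :=
    Finset.measurable_prod _ fun i _ => (m.measurable_block i).comp
      (measurable_snd.prodMk ((measurable_pi_apply i).comp measurable_fst))
  have hc : Measurable fun θ => ∫⁻ D, m.joint (D, θ) ∂(Measure.pi μ) :=
    m.measurable_joint.lintegral_prod_left'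
  rw [posterior, lintegral_withDensity_eq_lintegral_mul _ m.measurable_joint hF]
  have h : (m.joint * F) =ᵐ[(Measure.pi μ).prod ν] fun x =>
      ((∏ i, m.block i x.2 (x.1 i)) * ∫⁻ D, m.joint (D, x.2) ∂(Measure.pi μ)) * F x := by
    filter_upwards [m.joint_eq_block] with x hx
    rw [Pi.mul_apply, hx]
  rw [lintegral_congr_ae h]
  refine (lintegral_prod_symm' _ ((hb.mul (hc.comp measurable_snd)).mul hF)).trans ?_
  refine lintegral_congr fun θ => ?_
  have hbθ : Measurable fun D : (i : Fin k) → M i => ∏ i, m.block i θ (D i) :=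
    hb.comp measurable_prodMk_right
  have hFθ : Measurable fun D => F (D, θ) := hF.comp measurable_prodMk_right
  rw [piKernel_blockKernel_apply, lintegral_withDensity_eq_lintegral_mul _ hbθ hFθ,
    ← lintegral_const_mul _ (hbθ.mul hFθ)]
  refine lintegral_congr fun D => ?_
  simp only [Pi.mul_apply, Function.comp_apply]
  ring

/-- Redrawing a subset of the blocks preserves the posterior expectation over the missing data,
with weights that depend on the parameter only. -/
lemma lintegral_posterior_mul_subsetIStep (S : Finset (Fin k)) {g : Θ → ℝ≥0∞} (hg : Measurable g)
    {s : Set ((i : Fin k) → M i)} (hs : MeasurableSet s) :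
    ∫⁻ x, g x.2 * m.subsetIStep S x s ∂m.posterior
      = ∫⁻ x, g x.2 * (Prod.fst ⁻¹' s).indicator 1 x ∂m.posterior := by
  have hS : Measurable fun x => m.subsetIStep S x s := (m.subsetIStep S).measurable_coe hs
  have hi : Measurable ((Prod.fst ⁻¹' s).indicator 1 : ((i : Fin k) → M i) × Θ → ℝ≥0∞) :=
    measurable_one.indicator (measurable_fst hs)
  rw [m.lintegral_posterior_eq_block (by fun_prop), m.lintegral_posterior_eq_block (by fun_prop)]
  refine lintegral_congr fun θ => ?_
  congr 1
  have hSθ : Measurable fun D => m.subsetIStep S (D, θ) s := hS.comp measurable_prodMk_right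
  have hiθ : Measurable fun D : (i : Fin k) → M i =>
      ((Prod.fst ⁻¹' s).indicator 1 (D, θ) : ℝ≥0∞) := hi.comp measurable_prodMk_right
  dsimp only
  rw [lintegral_const_mul _ hSθ, lintegral_const_mul _ hiθ, m.lintegral_subsetIStep S θ hs,
    ← lintegral_indicator_one hs]
  rfl

/-- Each subset preserves the weighted integral separately, with its selection probability as the
weight; the weights then sum to `1` pointwise in the parameter. -/
lemma posterior_bind_adIStep : m.posterior.bind (m.adIStep q ε) = m.posterior.fst := by
  ext s hs
  have hS : ∀ S, Measurable fun x => m.subsetIStep S x s := fun S =>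
    (m.subsetIStep S).measurable_coe hs
  have hq : ∀ S, Measurable fun x : ((i : Fin k) → M i) × Θ => q.prob S x.2 := fun S =>
    (q.measurable_prob S).comp measurable_snd
  have hi : Measurable ((Prod.fst ⁻¹' s).indicator 1 : ((i : Fin k) → M i) × Θ → ℝ≥0∞) :=
    measurable_one.indicator (measurable_fst hs)
  have hε : ENNReal.ofReal ε + ENNReal.ofReal (1 - ε) = 1 := by
    rw [← ENNReal.ofReal_add ε.2.1 (sub_nonneg.2 ε.2.2)]; simp
  have hfull : ∫⁻ x, m.subsetIStep Finset.univ x s ∂m.posterior = m.posterior.fst s := by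
    have h := m.lintegral_posterior_mul_subsetIStep Finset.univ (g := fun _ => 1)
      measurable_const hs
    simp only [one_mul] at h
    rw [h, lintegral_indicator_one (measurable_fst hs), Measure.fst_apply hs]
  have hfrac : ∫⁻ x, m.fractionIStep q x s ∂m.posterior = m.posterior.fst s := by
    simp_rw [fractionIStep_apply']
    have hw : ∀ S, Measurable fun x => q.prob S x.2 * m.subsetIStep S x s := fun S =>
      (hq S).mul (hS S)
    have hwi : ∀ S, Measurable fun x : ((i : Fin k) → M i) × Θ =>
        q.prob S x.2 * (Prod.fst ⁻¹' s).indicator 1 x := fun S => (hq S).mul hi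
    rw [lintegral_finsetSum _ fun S _ => hw S]
    simp_rw [m.lintegral_posterior_mul_subsetIStep _ (q.measurable_prob _) hs]
    rw [← lintegral_finsetSum _ fun S _ => hwi S]
    simp_rw [← Finset.sum_mul, q.sum_prob, one_mul]
    rw [lintegral_indicator_one (measurable_fst hs), Measure.fst_apply hs]
  rw [Measure.bind_apply hs (m.adIStep q ε).measurable.aemeasurable]
  simp_rw [adIStep_apply, Measure.add_apply, Measure.smul_apply, smul_eq_mul]
  rw [lintegral_add_left ((hS _).const_mul _), lintegral_const_mul _ (hS _),
    lintegral_const_mul _ ((m.fractionIStep q).measurable_coe hs), hfull, hfrac, ← add_mul, hε,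
    one_mul]

/-- The posterior is invariant for the ADDA chain. -/
theorem invariant_addaKernel : (m.addaKernel q ε).Invariant m.posterior := by
  rw [Kernel.Invariant, addaKernel, ← Measure.comp_assoc, posterior_bind_adIStep,
    posterior_fst_bind_pStep]

/-- The ADDA kernel dominates `ε` times the kernel of the parent DA chain. -/
theorem smul_daKernel_le (x : ((i : Fin k) → M i) × Θ) :
    ENNReal.ofReal ε • m.daKernel x ≤ m.addaKernel q ε x := by
  refine Measure.le_iff.2 fun s hs => ?_
  rw [Measure.smul_apply, daKernel, addaKernel, Kernel.comp_apply' _ _ _ hs,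
    Kernel.comp_apply' _ _ _ hs, adIStep_apply, lintegral_add_measure, lintegral_smul_measure]
  exact le_self_add

end DAModel

end

theorem theorem1 {k : ℕ} {M : Fin k → Type*} [∀ i, MeasurableSpace (M i)]
    [∀ i, MeasurableSpace.CountablyGenerated (M i)]
    {Θ : Type*} [MeasurableSpace Θ] [MeasurableSpace.CountablyGenerated Θ]
    (μ : (i : Fin k) → Measure (M i)) [∀ i, SigmaFinite (μ i)] (ν : Measure Θ) [SigmaFinite ν]
    (m : DAModel μ ν) (r : ℝ) (hr : r ∈ Set.Ioo (0 : ℝ) 1) (q : FractionRule k Θ r)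
    (ε : Set.Icc (0 : ℝ) 1) (hε : 0 < (ε : ℝ))
    (hac : ∀ x, m.daKernel x ≪ m.posterior)
    (hDA : IsHarrisErgodic m.daKernel m.posterior) :
    IsHarrisErgodic (m.addaKernel q ε) m.posterior :=
  hDA.of_smul_le (ENNReal.ofReal_pos.2 hε).ne' (m.smul_daKernel_le q ε) hac
    (m.invariant_addaKernel q ε)
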